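/- For complex parameters with $d,e\notin\{0,-1,-2,\dots\}$ let $${}_3F_2\left(\begin{matrix}a,b,c\\ d,e\end{matrix}\,\Big|\,x\right)=\sum_{k=0}^\infty\frac{(a)_k(b)_k(c)_k}{(d)_k(e)_k\,k!}\,x^k,\qquad (s)_k=s(s+1)\cdots(s+k-1).$$ Let $\Omega=\{a\in\mathbb C:\ 3a\notin\{0,-1,-2,\dots\}\}$, which contains the half-plane $\operatorname{Re}a>0$. For every $a\in\Omega$ the series on the left below converges absolutely, and $${}_3F_2\left(\begin{matrix}a,\;3a-\tfrac12,\;\tfrac32-3a\\ 3a,\;\tfrac12\end{matrix}\,\Big|\,\frac34\right)=\frac{2\,\Gamma\left(\tfrac16\right)\Gamma(3a)\,\sin\left(\tfrac{\pi}{6}+\pi a\right)}{3^{3a}\,\Gamma\left(2a+\tfrac16\right)\Gamma(a)},$$ where $3^{3a}=e^{3a\ln 3}$ and $1/\Gamma$ is read as an entire function (so that the right-hand side is $0$ when $2a+\tfrac16\in\{0,-1,-2,\dots\}$). Both sides are analytic functions of $a$ on $\Omega$. Moreover, at each point $a=-n$, $n=0,1,2,\dots$, both sides have the same finite limit, so that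 the two sides extend analytically to these points and still agree there; in particular, this covers the whole half-plane $\operatorname{Re}a\ge 0$. -/

import Mathlib

open Filter Topology

noncomputable section

/-- The `k`-th term `(a)ₖ (b)ₖ (c)ₖ / ((d)ₖ (e)ₖ k!) * xᵏ` of the series `₃F₂(a, b, c; d, e | x)`,
where `(s)ₖ = s (s + 1) ⋯ (s + k - 1)` is the Pochhammer symbol. -/
def hypergeometric3F2Term (a b c d e x : ℂ) (k : ℕ) : ℂ :=
  ((ascPochhammer ℂ k).eval a * (ascPochhammer ℂ k).eval b * (ascPochhammer ℂ k).eval c) /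
    ((ascPochhammer ℂ k).eval d * (ascPochhammer ℂ k).eval e * (k.factorial : ℂ)) * x ^ k

/-- The generalized hypergeometric function `₃F₂(a, b, c; d, e | x)` as the sum of its series;
meaningful when neither `d` nor `e` is a nonpositive integer and the series converges. -/
def hypergeometric3F2 (a b c d e x : ℂ) : ℂ :=
  ∑' k : ℕ, hypergeometric3F2Term a b c d e x k

/-- The right-hand side
`2 Γ(1/6) Γ(3a) sin(π/6 + πa) / (3^{3a} Γ(2a + 1/6) Γ(a))`.
(At the points where `2a + 1/6` is a nonpositive integer, `1 / Γ(2a + 1/6)` is zero,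
which agrees with the entire function `1 / Γ`.) -/
def gammaQuotientRHS (a : ℂ) : ℂ :=
  2 * Complex.Gamma (1 / 6) * Complex.Gamma (3 * a) *
      Complex.sin ((Real.pi : ℂ) / 6 + (Real.pi : ℂ) * a) /
    ((3 : ℂ) ^ (3 * a) * Complex.Gamma (2 * a + 1 / 6) * Complex.Gamma a)

/-- The complex `a` for which the lower parameter `3a` is not a nonpositive integer.
It contains the half-plane `Re a > 0`. -/
def regularParams : Set ℂ := {a : ℂ | ∀ m : ℕ, 3 * a ≠ -(m : ℂ)}

end

/-! Suppose first that Re a > 1. The quotient (a)ₖ/(3a)ₖ equals B(a+k, 2a)/B(a, 2a), so the ₃F₂ is a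
Beta-weighted integral over [0,1] of ₂F₁(α, 1-α; 1/2; 3t/4) with α = 3a - 1/2
(`hasSum_mul_betaIntegral`). This ₂F₁ is elementary: at sin² θ it equals cos((2α-1)θ)/cos θ
(`cos_mul_tsum_sin_sq`).

The argument 3/4 matters because of the triple-angle formula. Put t = (4/3) sin² θ, so that 1 - t =
sin 3θ/(3 sin θ); the weight t^(a-1) (1-t)^(2a-1) dt then collapses to a constant times
sin(3θ)^(2a-1) cos θ dθ, and cos θ cancels (`sin_pow_substitution`). With φ = 3θ there remains the
integral over [0,π] of sin^(2a-1) φ · cos((2a-1+1/3)φ), which Cauchy's theorem on a rectangle turns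
into a Beta function (`integral_cos_cpow_mul_exp`, `integral_sin_cpow_mul_cos`). The Gamma(2a)
factors cancel and the stated quotient is left.

Both sides are analytic on the connected open set of regular parameters, the series because its
terms are locally dominated by a geometric series (`exists_norm_hypergeometric3F2Term_le`), so the
identity theorem removes the restriction Re a > 1. At a = -n the reflection formula replaces
Γ(3a)/Γ(a) by an expression continuous there (`Gamma_three_mul_div_Gamma`); the series, equal to the
right side on a punctured neighbourhood, has the same limit. -/

/-! ### Power series whose coefficient ratio tends to 1: convergence and termwise derivative. -/

theorem summable_norm_mul_pow_of_ratio_tendsto_one {b u : ℕ → ℂ} (h : ∀ k, b (k + 1) = u k * b k)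
    (hu : Tendsto u atTop (𝓝 1)) {r : ℝ} (hr0 : 0 ≤ r) (hr : r < 1) :
    Summable fun k => ‖b k‖ * r ^ k := by
  obtain ⟨q, hrq, hq⟩ := exists_between hr
  have h1 : Tendsto (fun k => ‖u k‖ * r) atTop (𝓝 r) := by
    simpa using hu.norm.mul_const r
  refine summable_of_ratio_norm_eventually_le hq ?_
  filter_upwards [h1.eventually (gt_mem_nhds hrq)] with k hk
  have : ‖b (k + 1)‖ * r ^ (k + 1) = (‖u k‖ * r) * (‖b k‖ * r ^ k) := by
    rw [h, norm_mul]; ring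
  rw [this, norm_mul, Real.norm_of_nonneg (by positivity : 0 ≤ ‖u k‖ * r)]
  gcongr

theorem hasSum_mul_pow_of_ratio_tendsto_one {b u : ℕ → ℂ} (h : ∀ k, b (k + 1) = u k * b k)
    (hu : Tendsto u atTop (𝓝 1)) {x : ℂ} (hx : ‖x‖ < 1) :
    HasSum (fun k => b k * x ^ k) (∑' k, b k * x ^ k) := by
  refine (Summable.of_norm ?_).hasSum
  simpa using summable_norm_mul_pow_of_ratio_tendsto_one h hu (norm_nonneg x) hx

theorem tendsto_natCast_add_div_natCast_add {𝕜 : Type*} [RCLike 𝕜] (p q : 𝕜) :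
    Tendsto (fun k : ℕ => ((k : 𝕜) + p) / (k + q)) atTop (𝓝 1) := by
  have h0 : Tendsto (fun k : ℕ => (k : 𝕜)⁻¹) atTop (𝓝 0) := tendsto_inv_atTop_nhds_zero_nat
  have h1 : Tendsto (fun k : ℕ => (1 + p * (k : 𝕜)⁻¹) / (1 + q * (k : 𝕜)⁻¹)) atTop (𝓝 1) := by
    have := ((h0.const_mul p).const_add 1).div ((h0.const_mul q).const_add 1) (by simp)
    simpa [Pi.div_def] using this
  refine h1.congr' ?_
  filter_upwards [eventually_gt_atTop 0] with k hk
  have : (k : 𝕜) ≠ 0 := by exact_mod_cast hk.ne'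
  rw [← mul_div_mul_left _ _ this]
  congr 1 <;> field_simp

/-- Makes the hypothesis stable under termwise differentiation: the differentiated series is again
one to which the convergence lemmas apply. -/
theorem exists_ratio_succ_mul_succ {b u : ℕ → ℂ} (h : ∀ k, b (k + 1) = u k * b k)
    (hu : Tendsto u atTop (𝓝 1)) :
    ∃ v : ℕ → ℂ, (∀ k, ((k + 1 : ℕ) + 1 : ℂ) * b (k + 1 + 1) = v k * ((k + 1) * b (k + 1))) ∧
      Tendsto v atTop (𝓝 1) := by
  refine ⟨fun k => ((k : ℂ) + 2) / (k + 1) * u (k + 1), fun k => ?_, ?_⟩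
  · have : (k : ℂ) + 1 ≠ 0 := Nat.cast_add_one_ne_zero k
    rw [h (k + 1)]
    push_cast
    field_simp
    ring
  · simpa using (tendsto_natCast_add_div_natCast_add (𝕜 := ℂ) 2 1).mul (hu.comp (tendsto_add_atTop_nat 1))

theorem hasDerivAt_tsum_mul_pow {b u : ℕ → ℂ} (h : ∀ k, b (k + 1) = u k * b k)
    (hu : Tendsto u atTop (𝓝 1)) {x : ℂ} (hx : ‖x‖ < 1) :
    HasDerivAt (fun z => ∑' k, b k * z ^ k) (∑' k : ℕ, ((k : ℂ) + 1) * b (k + 1) * x ^ k) x := by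
  obtain ⟨v, hv, hv1⟩ := exists_ratio_succ_mul_succ h hu
  obtain ⟨r, hxr, hr⟩ := exists_between hx
  have hr0 : 0 ≤ r := (norm_nonneg x).trans hxr.le
  have hs := summable_norm_mul_pow_of_ratio_tendsto_one
    (b := fun k => ((k : ℂ) + 1) * b (k + 1)) hv hv1 hr0 hr
  have hs' : Summable fun k : ℕ => ‖(k : ℂ) * b k‖ * r ^ (k - 1) := by
    rw [← summable_nat_add_iff 1]
    simpa using hs
  have hx' : x ∈ Metric.ball (0 : ℂ) r := by simpa using hxr
  have key := hasDerivAt_tsum_of_isPreconnected (g := fun k z => b k * z ^ k)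
    (g' := fun k z => (k : ℂ) * b k * z ^ (k - 1)) (y₀ := 0) hs' Metric.isOpen_ball
    (convex_ball (0 : ℂ) r).isPreconnected
    (fun k y _ => by
      convert! (hasDerivAt_pow k y).const_mul (b k) using 1
      ring)
    (fun k y hy => by
      have hy : ‖y‖ ≤ r := by simpa using (Metric.mem_ball.1 hy).le
      rw [norm_mul, norm_pow]
      gcongr)
    (Metric.mem_ball_self ((norm_nonneg x).trans_lt hxr))
    (hasSum_mul_pow_of_ratio_tendsto_one h hu (by simp)).summable hx'
  convert! key using 1
  have hsx : Summable fun k : ℕ => (k : ℂ) * b k * x ^ (k - 1) := by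
    refine Summable.of_norm_bounded hs' fun k => ?_
    rw [norm_mul, norm_pow]
    gcongr
  rw [hsx.tsum_eq_zero_add]
  simp

theorem hasSum_natCast_mul_pow {b u : ℕ → ℂ} (h : ∀ k, b (k + 1) = u k * b k)
    (hu : Tendsto u atTop (𝓝 1)) {x : ℂ} (hx : ‖x‖ < 1) :
    HasSum (fun k : ℕ => (k : ℂ) * b k * x ^ k)
      (x * ∑' k : ℕ, ((k : ℂ) + 1) * b (k + 1) * x ^ k) := by
  obtain ⟨v, hv, hv1⟩ := exists_ratio_succ_mul_succ h hu
  have := (hasSum_mul_pow_of_ratio_tendsto_one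
    (b := fun k => ((k : ℂ) + 1) * b (k + 1)) hv hv1 hx).mul_left x
  rw [← hasSum_nat_add_iff' 1]
  simp only [Finset.range_one, Finset.sum_singleton, Nat.cast_zero, zero_mul, sub_zero]
  convert! this using 2 with k
  push_cast
  ring

/-! ### The elementary ₂F₁. -/

/-- The closed form `₂F₁(α, 1 - α; 1/2; sin² θ) cos θ = cos ((2 α - 1) θ)`. -/
theorem cos_mul_tsum_sin_sq {α : ℂ} {c : ℕ → ℂ} (c0 : c 0 = 1)
    (hc : ∀ k : ℕ, c (k + 1) = (α + k) * (1 - α + k) / ((1 / 2 + k) * (k + 1)) * c k)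
    {θ : ℝ} (h0 : 0 ≤ θ) (hθ : θ < Real.pi / 2) :
    Complex.cos θ * ∑' k, c k * (Complex.sin θ ^ 2) ^ k = Complex.cos ((2 * α - 1) * θ) := by
  set m := 2 * α - 1 with hm
  have n1 : ∀ k : ℕ, (2 * k + 1 : ℂ) ≠ 0 := fun k => by exact_mod_cast (by omega : 2 * k + 1 ≠ 0)
  have n3 : ∀ k : ℕ, (2 * k + 3 : ℂ) ≠ 0 := fun k => by exact_mod_cast (by omega : 2 * k + 3 ≠ 0)
  have n2 : ∀ k : ℕ, (k + 1 : ℂ) ≠ 0 := fun k => Nat.cast_add_one_ne_zero k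
  set u : ℕ → ℂ := fun k => (α + k) * (1 - α + k) / ((1 / 2 + k) * (k + 1)) with hu_def
  have hu : Tendsto u atTop (𝓝 1) := by
    have := (tendsto_natCast_add_div_natCast_add α (1 / 2)).mul
      (tendsto_natCast_add_div_natCast_add (1 - α) 1)
    rw [mul_one] at this
    refine this.congr fun k => ?_
    rw [div_mul_div_comm]
    simp only [hu_def]
    ring_nf
  -- Chosen so that sin θ · p(sin² θ) is the antiderivative of cos θ · g(sin² θ). This replaces the
  -- second-order hypergeometric equation by a first-order system.
  set b : ℕ → ℂ := fun k => c k / (2 * k + 1) with hb_def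
  have hb : ∀ k, b (k + 1) = (((k : ℂ) + 1 / 2) / (k + 3 / 2) * u k) * b k := fun k => by
    have e1 : (k : ℂ) + 1 / 2 = (2 * k + 1) / 2 := by ring
    have e2 : (k : ℂ) + 3 / 2 = (2 * k + 3) / 2 := by ring
    have e3 : (2 * ((k + 1 : ℕ) : ℂ) + 1) = 2 * k + 3 := by push_cast; ring
    simp only [hb_def]
    rw [show c (k + 1) = u k * c k from hc k, e1, e2, e3]
    have h1 := n1 k
    rw [show u k * c k = u k * (2 * k + 1) * (c k / (2 * k + 1)) by field_simp]
    have := n3 k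
    field_simp
  have hbu : Tendsto (fun k : ℕ => ((k : ℂ) + 1 / 2) / (k + 3 / 2) * u k) atTop (𝓝 1) := by
    simpa using (tendsto_natCast_add_div_natCast_add (𝕜 := ℂ) (1 / 2) (3 / 2)).mul hu
  set g : ℂ → ℂ := fun x => ∑' k, c k * x ^ k with hg
  set p : ℂ → ℂ := fun x => ∑' k, b k * x ^ k with hp
  set g' : ℂ → ℂ := fun x => ∑' k : ℕ, ((k : ℂ) + 1) * c (k + 1) * x ^ k with hg'
  set p' : ℂ → ℂ := fun x => ∑' k : ℕ, ((k : ℂ) + 1) * b (k + 1) * x ^ k with hp'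
  have R1 : ∀ x : ℂ, ‖x‖ < 1 → p x + 2 * (x * p' x) = g x := fun x hx => by
    have h1 := (hasSum_mul_pow_of_ratio_tendsto_one hb hbu hx).add
      ((hasSum_natCast_mul_pow hb hbu hx).mul_left 2)
    refine h1.unique ?_
    convert! hasSum_mul_pow_of_ratio_tendsto_one hc hu hx using 2 with k
    simp only [hb_def]
    have := n1 k
    field_simp
    ring
  -- Coefficientwise this is 4(α+k)(1-α+k) - (2k+1)² = -(2α-1)².
  have R2 : ∀ x : ℂ, ‖x‖ < 1 → 2 * (1 - x) * g' x - g x = -m ^ 2 * p x := fun x hx => by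
    obtain ⟨v, hv, hv1⟩ := exists_ratio_succ_mul_succ hc hu
    have h1 := (((hasSum_mul_pow_of_ratio_tendsto_one
      (b := fun k => ((k : ℂ) + 1) * c (k + 1)) hv hv1 hx).mul_left 2).sub
      ((hasSum_natCast_mul_pow hc hu hx).mul_left 2)).sub
      (hasSum_mul_pow_of_ratio_tendsto_one hc hu hx)
    have h2 := (hasSum_mul_pow_of_ratio_tendsto_one hb hbu hx).mul_left (-m ^ 2)
    rw [show 2 * (1 - x) * g' x - g x = 2 * g' x - 2 * (x * g' x) - g x by ring]
    refine h1.unique ?_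
    convert! h2 using 2 with k
    simp only [hb_def]
    rw [hc k, hm]
    have e1 : 1 / 2 + (k : ℂ) = (2 * k + 1) / 2 := by ring
    rw [e1]
    have := n1 k
    have := n2 k
    field_simp
    ring
  have hsin : ∀ t ∈ Set.Icc (0 : ℝ) θ, ‖Complex.sin t ^ 2‖ < 1 := fun t ht => by
    have hcos : 0 < Real.cos t := Real.cos_pos_of_mem_Ioo ⟨by linarith [ht.1, Real.pi_pos], by
      linarith [ht.2]⟩
    rw [← Complex.ofReal_sin, ← Complex.ofReal_pow, Complex.norm_real, Real.norm_of_nonneg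
      (sq_nonneg _)]
    nlinarith [Real.sin_sq_add_cos_sq t]
  have dsq : ∀ t : ℂ, HasDerivAt (fun z => Complex.sin z ^ 2)
      (2 * Complex.sin t * Complex.cos t) t := fun t => by
    simpa using (Complex.hasDerivAt_sin t).fun_pow 2
  have dy : ∀ t ∈ Set.Icc (0 : ℝ) θ, HasDerivAt (fun z : ℂ => Complex.cos z * g (Complex.sin z ^ 2))
      (-m ^ 2 * (Complex.sin t * p (Complex.sin t ^ 2))) t := fun t ht => by
    have h1 := (hasDerivAt_tsum_mul_pow hc hu (hsin t ht)).comp (t : ℂ) (dsq t)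
    convert! (Complex.hasDerivAt_cos (t : ℂ)).mul h1 using 1
    have h2 := R2 _ (hsin t ht)
    have h3 := Complex.sin_sq_add_cos_sq (t : ℂ)
    change _ = -Complex.sin t * g (Complex.sin t ^ 2) + Complex.cos t *
      (g' (Complex.sin t ^ 2) * (2 * Complex.sin t * Complex.cos t))
    linear_combination (-Complex.sin t) * h2 -
      2 * Complex.sin t * g' (Complex.sin t ^ 2) * h3
  have dq : ∀ t ∈ Set.Icc (0 : ℝ) θ, HasDerivAt (fun z : ℂ => Complex.sin z * p (Complex.sin z ^ 2))
      (Complex.cos t * g (Complex.sin t ^ 2)) t := fun t ht => by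
    have h1 := (hasDerivAt_tsum_mul_pow hb hbu (hsin t ht)).comp (t : ℂ) (dsq t)
    convert! (Complex.hasDerivAt_sin (t : ℂ)).mul h1 using 1
    have h2 := R1 _ (hsin t ht)
    change _ = Complex.cos t * p (Complex.sin t ^ 2) + Complex.sin t *
      (p' (Complex.sin t ^ 2) * (2 * Complex.sin t * Complex.cos t))
    linear_combination (-Complex.cos t) * h2
  have dcos : ∀ t : ℂ, HasDerivAt (fun z => Complex.cos (m * z)) (-Complex.sin (m * t) * m) t :=
    fun t => by simpa using ((hasDerivAt_id t).const_mul m).ccos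
  have dsin : ∀ t : ℂ, HasDerivAt (fun z => Complex.sin (m * z)) (Complex.cos (m * t) * m) t :=
    fun t => by simpa using ((hasDerivAt_id t).const_mul m).csin
  have const : ∀ f : ℂ → ℂ, (∀ t ∈ Set.Icc (0 : ℝ) θ, HasDerivAt f 0 t) → f θ = f 0 := by
    intro f hf
    have h1 : ∀ t ∈ Set.Icc (0 : ℝ) θ, HasDerivAt (fun t : ℝ => f t) 0 t := fun t ht =>
      (hf t ht).comp_ofReal
    have := constant_of_has_deriv_right_zero
      (fun t ht => (h1 t ht).continuousAt.continuousWithinAt)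
      (fun t ht => (h1 t ⟨ht.1, ht.2.le⟩).hasDerivWithinAt) θ ⟨h0, le_rfl⟩
    simpa using this
  have g0 : g 0 = 1 := by
    simp only [hg]
    rw [tsum_eq_single 0 (fun k hk => by simp [hk])]
    simp [c0]
  -- With y = cos θ · g and q = sin θ · p, the system is y' = -m² q, q' = y. Its two first
  -- integrals, y cos mθ + m q sin mθ and y sin mθ - m q cos mθ, equal 1 and 0 at θ = 0; solving for
  -- y gives cos mθ.
  have hA := const (fun z => Complex.cos z * g (Complex.sin z ^ 2) * Complex.cos (m * z) +
      m * (Complex.sin z * p (Complex.sin z ^ 2)) * Complex.sin (m * z)) fun t ht => by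
    convert! ((dy t ht).mul (dcos t)).add (((dq t ht).const_mul m).mul (dsin t)) using 1
    ring
  have hB := const (fun z => Complex.cos z * g (Complex.sin z ^ 2) * Complex.sin (m * z) -
      m * (Complex.sin z * p (Complex.sin z ^ 2)) * Complex.cos (m * z)) fun t ht => by
    convert! ((dy t ht).mul (dsin t)).sub (((dq t ht).const_mul m).mul (dcos t)) using 1
    ring
  simp [g0] at hA hB
  have h3 := Complex.sin_sq_add_cos_sq (m * θ)
  change Complex.cos θ * g (Complex.sin θ ^ 2) = _
  linear_combination Complex.cos (m * θ) * hA + Complex.sin (m * θ) * hB -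
    Complex.cos θ * g (Complex.sin θ ^ 2) * h3

/-! ### The trigonometric integral by Cauchy's theorem on a rectangle. -/

/-- For Re ζ ≤ 0 the base 1 + exp(2ζ) stays in the closed right half-plane, off the branch cut
except for its zeros, such as ζ = ±iπ/2; there Re s > 1 gives continuity. -/
theorem continuousOn_one_add_exp_cpow_mul_exp {s : ℂ} (hs : 1 < s.re) (μ : ℂ) :
    ContinuousOn (fun ζ : ℂ => (1 + Complex.exp (2 * ζ)) ^ (s - 1) * Complex.exp (μ * ζ))
      {ζ | ζ.re ≤ 0} := by
  intro ζ hζ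
  have h1 : ‖Complex.exp (2 * ζ)‖ ≤ 1 := by
    rw [Complex.norm_exp, Real.exp_le_one_iff]
    have : ζ.re ≤ 0 := hζ
    simp only [Complex.mul_re, Complex.re_ofNat, Complex.im_ofNat]
    linarith
  have h2 : 0 ≤ (1 + Complex.exp (2 * ζ)).re := by
    have := (abs_le.1 ((Complex.abs_re_le_norm _).trans h1)).1
    simp only [Complex.add_re, Complex.one_re]
    linarith
  have h3 := Complex.continuousAt_cpow_const_of_re_pos (Or.inl h2) (w := s - 1) (by simpa using hs)
  have h4 : ContinuousAt (fun ζ : ℂ => 1 + Complex.exp (2 * ζ)) ζ := by fun_prop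
  have h5 : ContinuousAt (fun ζ : ℂ => Complex.exp (μ * ζ)) ζ := by fun_prop
  exact ((ContinuousAt.comp (f := fun ζ : ℂ => 1 + Complex.exp (2 * ζ)) h3 h4).mul
    h5).continuousWithinAt

theorem differentiableOn_one_add_exp_cpow_mul_exp (s μ : ℂ) :
    DifferentiableOn ℂ (fun ζ : ℂ => (1 + Complex.exp (2 * ζ)) ^ (s - 1) * Complex.exp (μ * ζ))
      {ζ | ζ.re < 0} := by
  intro ζ hζ
  have h1 : ‖Complex.exp (2 * ζ)‖ < 1 := by
    rw [Complex.norm_exp, Real.exp_lt_one_iff]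
    have : ζ.re < 0 := hζ
    simp only [Complex.mul_re, Complex.re_ofNat, Complex.im_ofNat]
    linarith
  have h2 : 0 < (1 + Complex.exp (2 * ζ)).re := by
    have := (abs_lt.1 ((Complex.abs_re_le_norm _).trans_lt h1)).1
    simp only [Complex.add_re, Complex.one_re]
    linarith
  have h3 : DifferentiableAt ℂ (fun ζ : ℂ => 1 + Complex.exp (2 * ζ)) ζ := by fun_prop
  have h4 : DifferentiableAt ℂ (fun ζ : ℂ => Complex.exp (μ * ζ)) ζ := by fun_prop
  exact ((h3.cpow_const (Or.inl h2)).mul h4).differentiableWithinAt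

theorem exists_norm_one_add_cpow_le {s : ℂ} (hs : 1 < s.re) :
    ∃ C, ∀ w : ℂ, ‖w‖ ≤ 1 → ‖(1 + w) ^ (s - 1)‖ ≤ C := by
  have hc : ContinuousOn (fun w : ℂ => (1 + w) ^ (s - 1)) (Metric.closedBall 0 1) := by
    intro w hw
    have hw : ‖w‖ ≤ 1 := by simpa using hw
    have h2 : 0 ≤ (1 + w).re := by
      have := (abs_le.1 ((Complex.abs_re_le_norm _).trans hw)).1
      simp only [Complex.add_re, Complex.one_re]
      linarith
    have h3 := Complex.continuousAt_cpow_const_of_re_pos (Or.inl h2) (w := s - 1)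
      (by simpa using hs)
    have h4 : ContinuousAt (fun w : ℂ => 1 + w) w := by fun_prop
    exact (ContinuousAt.comp (f := fun w : ℂ => 1 + w) h3 h4).continuousWithinAt
  obtain ⟨C, hC⟩ := (isCompact_closedBall (0 : ℂ) 1).exists_bound_of_continuousOn hc
  exact ⟨C, fun w hw => hC w (by simpa using hw)⟩

/-- Since 1 + exp(2iψ) = 2 cos ψ · exp(iψ) with ψ inside the principal range of the argument, the
power splits without a branch correction. At the endpoints cos ψ = 0, and both sides vanish because
s ≠ 1. -/
theorem one_add_exp_two_mul_I_cpow {s : ℂ} (hs : s ≠ 1) {ψ : ℝ}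
    (h : ψ ∈ Set.Icc (-(Real.pi / 2)) (Real.pi / 2)) :
    (1 + Complex.exp (2 * (ψ * Complex.I))) ^ (s - 1) =
      2 ^ (s - 1) * (Real.cos ψ : ℂ) ^ (s - 1) * Complex.exp (Complex.I * (s - 1) * ψ) := by
  have h1 : 1 + Complex.exp (2 * (ψ * Complex.I)) =
      ((2 * Real.cos ψ : ℝ) : ℂ) * Complex.exp (ψ * Complex.I) := by
    push_cast
    rw [Complex.two_cos, add_mul, ← Complex.exp_add, ← Complex.exp_add, neg_mul, neg_add_cancel,
      Complex.exp_zero, ← two_mul, add_comm]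
  have hs' : s - 1 ≠ 0 := sub_ne_zero.2 hs
  rw [h1]
  rcases (Real.cos_nonneg_of_mem_Icc h).eq_or_lt with h0 | h0
  · simp [← h0, hs']
  · have e : ((2 : ℂ)) ^ (s - 1) * (Real.cos ψ : ℂ) ^ (s - 1) =
        ((2 * Real.cos ψ : ℝ) : ℂ) ^ (s - 1) := by
      have := Complex.mul_cpow_ofReal_nonneg (a := 2) (b := Real.cos ψ) (by norm_num) h0.le (s - 1)
      push_cast at this ⊢
      exact this.symm
    have hne : ((2 * Real.cos ψ : ℝ) : ℂ) ≠ 0 := by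
      exact_mod_cast (by positivity : (2 * Real.cos ψ) ≠ 0)
    rw [e, Complex.cpow_def_of_ne_zero (mul_ne_zero hne (Complex.exp_ne_zero _)),
      Complex.cpow_def_of_ne_zero hne, Complex.log_ofReal_mul (by positivity)
      (Complex.exp_ne_zero _), ← Complex.exp_add, Complex.log_exp, ← Complex.ofReal_log
      (by positivity)]
    · ring_nf
    · simp only [Complex.mul_im, Complex.ofReal_re, Complex.I_im, Complex.ofReal_im, Complex.I_re]
      linarith [h.1, Real.pi_pos]
    · simp only [Complex.mul_im, Complex.ofReal_re, Complex.I_im, Complex.ofReal_im, Complex.I_re]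
      linarith [h.2, Real.pi_pos]

/-- The substitution u = exp(2x) identifies the horizontal sides of the rectangle with truncated
Beta integrals. -/
theorem integral_one_sub_exp_cpow_mul_exp {s : ℂ} (hs : 1 < s.re) (μ : ℂ) (R : ℝ) (hR : 0 ≤ R) :
    ∫ x in (-R)..0, (1 - Complex.exp (2 * (x : ℂ))) ^ (s - 1) * Complex.exp (μ * x) =
      (1 / 2) * ∫ u in (Real.exp (-(2 * R)))..1,
        (u : ℂ) ^ (μ / 2 - 1) * (1 - (u : ℂ)) ^ (s - 1) := by
  have hd : ∀ x ∈ Set.uIcc (-R) 0, HasDerivAt (fun x : ℝ => Real.exp (2 * x))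
      (Real.exp (2 * x) * 2) x := fun x _ => by
    simpa using ((hasDerivAt_id x).const_mul 2).exp
  have key := intervalIntegral.integral_deriv_smul_comp' hd (by fun_prop)
    (g := fun u : ℝ => (u : ℂ) ^ (μ / 2 - 1) * (1 - (u : ℂ)) ^ (s - 1)) ?_
  · rw [show Real.exp (2 * -R) = Real.exp (-(2 * R)) by ring_nf, mul_zero, Real.exp_zero] at key
    rw [← key, ← intervalIntegral.integral_const_mul]
    refine intervalIntegral.integral_congr fun x _ => ?_
    simp only [Function.comp, Complex.real_smul]
    push_cast
    rw [Complex.cpow_def_of_ne_zero (Complex.exp_ne_zero _), ← Complex.ofReal_ofNat,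
      ← Complex.ofReal_mul, ← Complex.ofReal_exp, ← Complex.ofReal_log (Real.exp_pos _).le,
      Real.log_exp, Complex.ofReal_exp]
    have : Complex.exp (μ * x) = Complex.exp ((2 * x : ℝ) : ℂ) *
        Complex.exp (((2 * x : ℝ) : ℂ) * (μ / 2 - 1)) := by
      rw [← Complex.exp_add]
      push_cast
      ring_nf
    rw [this]
    push_cast
    ring
  · rintro _ ⟨x, hx, rfl⟩
    rw [Set.uIcc_of_le (by linarith)] at hx
    have hx1 : Real.exp (2 * x) ≤ 1 := Real.exp_le_one_iff.2 (by linarith [hx.2])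
    have h1 : ContinuousAt (fun u : ℝ => (u : ℂ) ^ (μ / 2 - 1)) (Real.exp (2 * x)) :=
      Complex.continuousAt_ofReal_cpow_const _ _ (Or.inr (Real.exp_pos _).ne')
    have h2 := Complex.continuousAt_cpow_const_of_re_pos (z := 1 - (Real.exp (2 * x) : ℝ))
      (w := s - 1) (Or.inl (by simpa [← Complex.ofReal_exp] using hx1)) (by simpa using hs)
    have h3 : ContinuousAt (fun u : ℝ => 1 - (u : ℂ)) (Real.exp (2 * x)) := by fun_prop
    exact (h1.mul (ContinuousAt.comp (f := fun u : ℝ => 1 - (u : ℂ)) h2 h3)).continuousWithinAt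

/-- Integrate (1 + exp(2ζ))^(s-1) exp(μζ) around -R ≤ Re ζ ≤ 0, |Im ζ| ≤ π/2. The right side is the
wanted integral up to 2^(s-1). On the horizontal sides the base is 1 - exp(2x), so they give one
Beta integral with phases exp(±iπμ/2), whose difference makes the sine. The left side vanishes as R
→ ∞. -/
theorem integral_cos_cpow_mul_exp {s μ : ℂ} (hs : 1 < s.re) (hμ : 0 < μ.re) :
    ∫ ψ in (-(Real.pi / 2))..(Real.pi / 2),
        (Real.cos ψ : ℂ) ^ (s - 1) * Complex.exp (Complex.I * (s - 1 + μ) * ψ) =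
      2 ^ (1 - s) * Complex.sin (Real.pi * μ / 2) * Complex.betaIntegral (μ / 2) s := by
  set K := ∫ ψ in (-(Real.pi / 2))..(Real.pi / 2),
    (Real.cos ψ : ℂ) ^ (s - 1) * Complex.exp (Complex.I * (s - 1 + μ) * ψ) with hK
  have hs1 : s ≠ 1 := fun h => by simp [h] at hs
  set f : ℂ → ℂ := fun ζ => (1 + Complex.exp (2 * ζ)) ^ (s - 1) * Complex.exp (μ * ζ) with hf
  set L : ℝ → ℂ := fun R => ∫ y in (-(Real.pi / 2))..(Real.pi / 2), f ((-R : ℝ) + y * Complex.I)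
    with hL
  set B : ℝ → ℂ := fun ε => ∫ u in ε..1, (u : ℂ) ^ (μ / 2 - 1) * (1 - (u : ℂ)) ^ (s - 1) with hB
  have main : ∀ R : ℝ, 0 ≤ R →
      2 ^ (s - 1) * K = Complex.sin (Real.pi * μ / 2) * B (Real.exp (-(2 * R))) + L R := by
    intro R hR
    have cauchy := Complex.integral_boundary_rect_eq_zero_of_continuousOn_of_differentiableOn f
      (⟨-R, -(Real.pi / 2)⟩ : ℂ) (⟨0, Real.pi / 2⟩ : ℂ)
      ((continuousOn_one_add_exp_cpow_mul_exp hs μ).mono fun ζ hζ => by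
        have := hζ.1
        simp only [Set.mem_preimage, Set.uIcc_of_le (neg_nonpos.2 hR)] at this
        exact this.2)
      ((differentiableOn_one_add_exp_cpow_mul_exp s μ).mono fun ζ hζ => by
        have := hζ.1
        simp only [Set.mem_preimage, max_eq_right (neg_nonpos.2 hR)] at this
        exact this.2)
    simp only [smul_eq_mul] at cauchy
    have hlow : ∫ x : ℝ in (-R)..0, f (x + (-(Real.pi / 2) : ℝ) * Complex.I) =
        Complex.exp (-(Real.pi * μ / 2 * Complex.I)) * ((1 / 2) * B (Real.exp (-(2 * R)))) := by
      rw [hB, ← integral_one_sub_exp_cpow_mul_exp hs μ R hR, ← intervalIntegral.integral_const_mul]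
      refine intervalIntegral.integral_congr fun x _ => ?_
      simp only [hf]
      have e1 : Complex.exp (2 * (x + (-(Real.pi / 2) : ℝ) * Complex.I)) =
          -Complex.exp (2 * x) := by
        rw [show (2 * (x + (-(Real.pi / 2) : ℝ) * Complex.I) : ℂ) =
          2 * x - Real.pi * Complex.I by push_cast; ring, Complex.exp_sub, Complex.exp_pi_mul_I]
        ring
      have e2 : Complex.exp (μ * (x + (-(Real.pi / 2) : ℝ) * Complex.I)) =
          Complex.exp (-(Real.pi * μ / 2 * Complex.I)) * Complex.exp (μ * x) := by
        rw [← Complex.exp_add]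
        push_cast
        ring_nf
      rw [e1, e2]
      ring_nf
    have hhigh : ∫ x : ℝ in (-R)..0, f (x + (Real.pi / 2 : ℝ) * Complex.I) =
        Complex.exp (Real.pi * μ / 2 * Complex.I) * ((1 / 2) * B (Real.exp (-(2 * R)))) := by
      rw [hB, ← integral_one_sub_exp_cpow_mul_exp hs μ R hR, ← intervalIntegral.integral_const_mul]
      refine intervalIntegral.integral_congr fun x _ => ?_
      simp only [hf]
      have e1 : Complex.exp (2 * (x + (Real.pi / 2 : ℝ) * Complex.I)) =
          -Complex.exp (2 * x) := by
        rw [show (2 * (x + (Real.pi / 2 : ℝ) * Complex.I) : ℂ) =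
          2 * x + Real.pi * Complex.I by push_cast; ring, Complex.exp_add, Complex.exp_pi_mul_I]
        ring
      have e2 : Complex.exp (μ * (x + (Real.pi / 2 : ℝ) * Complex.I)) =
          Complex.exp (Real.pi * μ / 2 * Complex.I) * Complex.exp (μ * x) := by
        rw [← Complex.exp_add]
        push_cast
        ring_nf
      rw [e1, e2]
      ring_nf
    have hright : ∫ y : ℝ in (-(Real.pi / 2))..(Real.pi / 2), f ((0 : ℝ) + y * Complex.I) =
        2 ^ (s - 1) * K := by
      rw [hK, ← intervalIntegral.integral_const_mul]
      refine intervalIntegral.integral_congr fun y hy => ?_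
      rw [Set.uIcc_of_le (by linarith [Real.pi_pos])] at hy
      simp only [hf, Complex.ofReal_zero, zero_add]
      rw [one_add_exp_two_mul_I_cpow hs1 hy, mul_assoc, mul_assoc, mul_assoc, ← Complex.exp_add]
      ring_nf
    rw [hlow, hhigh, hright] at cauchy
    have hsin := Complex.two_sin (Real.pi * μ / 2)
    rw [neg_mul] at hsin
    change _ - Complex.I * L R = 0 at cauchy
    linear_combination (-Complex.I) * cauchy -
      (1 / 2) * B (Real.exp (-(2 * R))) * hsin + (2 ^ (s - 1) * K - L R) * Complex.I_sq
  -- The Beta integrand is integrable on [0,1], so its primitive is continuous in the lower limit,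
  -- up to 0.
  have hBlim : Tendsto (fun R : ℝ => B (Real.exp (-(2 * R)))) atTop
      (𝓝 (Complex.betaIntegral (μ / 2) s)) := by
    have hint := Complex.betaIntegral_convergent (u := μ / 2) (v := s)
      (by simpa using hμ) (by linarith)
    have hcont : ContinuousOn B (Set.uIcc 0 1) := by
      refine intervalIntegral.continuousOn_primitive_interval_left ?_
      rw [Set.uIcc_of_le zero_le_one]
      exact (intervalIntegrable_iff_integrableOn_Icc_of_le zero_le_one).1 hint
    have h0 := hcont 0 Set.left_mem_uIcc
    refine Tendsto.comp h0 (tendsto_nhdsWithin_iff.2 ⟨?_, ?_⟩)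
    · refine Real.tendsto_exp_atBot.comp (tendsto_neg_atTop_atBot.comp ?_)
      exact tendsto_id.const_mul_atTop two_pos
    · filter_upwards [eventually_ge_atTop 0] with R hR
      rw [Set.uIcc_of_le zero_le_one]
      exact ⟨(Real.exp_pos _).le, Real.exp_le_one_iff.2 (by linarith)⟩
  have hLlim : Tendsto L atTop (𝓝 0) := by
    obtain ⟨C, hC⟩ := exists_norm_one_add_cpow_le hs
    have hC0 : 0 ≤ C := (norm_nonneg _).trans (hC 0 (by simp))
    -- Bounds the factor exp(-Im μ · y) of |exp(μζ)| on the left side; the other factor, exp(-Re μ ·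
    -- R), supplies the decay.
    set D := Real.exp (|μ.im| * (Real.pi / 2)) with hD
    have hbd : ∀ R : ℝ, 0 ≤ R →
        ‖L R‖ ≤ C * (Real.exp (-(μ.re * R)) * D) * |Real.pi / 2 - -(Real.pi / 2)| := by
      intro R hR
      refine intervalIntegral.norm_integral_le_of_norm_le_const fun y hy => ?_
      rw [Set.uIoc_of_le (by linarith [Real.pi_pos])] at hy
      have hy' : |y| ≤ Real.pi / 2 := abs_le.2 ⟨hy.1.le, hy.2⟩
      simp only [hf, norm_mul]
      gcongr
      · refine hC _ ?_
        rw [Complex.norm_exp, Real.exp_le_one_iff]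
        simpa using hR
      · rw [Complex.norm_exp, hD, ← Real.exp_add, Real.exp_le_exp]
        have : -(μ.im * y) ≤ |μ.im| * (Real.pi / 2) :=
          (neg_le_abs _).trans (by rw [abs_mul]; gcongr)
        simp
        linarith
    have hlim : Tendsto (fun R : ℝ =>
        C * (Real.exp (-(μ.re * R)) * D) * |Real.pi / 2 - -(Real.pi / 2)|) atTop (𝓝 0) := by
      have : Tendsto (fun R : ℝ => Real.exp (-(μ.re * R))) atTop (𝓝 0) :=
        Real.tendsto_exp_atBot.comp (tendsto_neg_atTop_atBot.comp (tendsto_id.const_mul_atTop hμ))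
      simpa using ((this.mul_const D).const_mul C).mul_const |Real.pi / 2 - -(Real.pi / 2)|
    refine squeeze_zero_norm' ?_ hlim
    filter_upwards [eventually_ge_atTop 0] with R hR using hbd R hR
  have hlim := (hBlim.const_mul (Complex.sin (Real.pi * μ / 2))).add hLlim
  have h2 : 2 ^ (s - 1) * K = Complex.sin (Real.pi * μ / 2) * Complex.betaIntegral (μ / 2) s := by
    refine tendsto_nhds_unique (tendsto_const_nhds.congr' ?_) (by simpa using hlim)
    filter_upwards [eventually_ge_atTop 0] with R hR using main R hR
  rw [mul_assoc, ← h2, ← mul_assoc, ← Complex.cpow_add _ _ two_ne_zero]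
  simp

/-- Shift by π/2 to turn sine into cosine and write the cosine factor as two exponentials; they
contribute equal integrals by the symmetry ψ ↦ -ψ, so their phases add up to a cosine. -/
theorem integral_sin_cpow_mul_cos {s μ : ℂ} (hs : 1 < s.re) (hμ : 0 < μ.re) :
    ∫ φ in (0 : ℝ)..Real.pi, (Real.sin φ : ℂ) ^ (s - 1) * Complex.cos ((s - 1 + μ) * φ) =
      Complex.cos ((s - 1 + μ) * (Real.pi / 2)) *
        (2 ^ (1 - s) * Complex.sin (Real.pi * μ / 2) * Complex.betaIntegral (μ / 2) s) := by
  set b := s - 1 + μ with hb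
  set h : ℝ → ℂ := fun ψ => (Real.cos ψ : ℂ) ^ (s - 1) * Complex.exp (Complex.I * b * ψ) with hh
  have hcont : ContinuousOn h (Set.uIcc (-(Real.pi / 2)) (Real.pi / 2)) := by
    intro ψ hψ
    rw [Set.uIcc_of_le (by linarith [Real.pi_pos])] at hψ
    have h1 := Complex.continuousAt_cpow_const_of_re_pos (z := (Real.cos ψ : ℂ)) (w := s - 1)
      (Or.inl (by rw [Complex.ofReal_re]; exact Real.cos_nonneg_of_mem_Icc hψ)) (by simpa using hs)
    have h2 : ContinuousAt (fun ψ : ℝ => (Real.cos ψ : ℂ)) ψ := by fun_prop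
    have h3 : ContinuousAt (fun ψ : ℝ => Complex.exp (Complex.I * b * ψ)) ψ := by fun_prop
    exact ((ContinuousAt.comp (f := fun ψ : ℝ => (Real.cos ψ : ℂ)) h1 h2).mul
      h3).continuousWithinAt
  have hint : IntervalIntegrable h MeasureTheory.volume (-(Real.pi / 2)) (Real.pi / 2) :=
    hcont.intervalIntegrable
  have hint' : IntervalIntegrable (fun ψ => h (-ψ)) MeasureTheory.volume
      (-(Real.pi / 2)) (Real.pi / 2) := by
    refine (hcont.comp continuousOn_neg fun ψ hψ => ?_).intervalIntegrable
    rw [Set.uIcc_of_le (by linarith [Real.pi_pos])] at hψ ⊢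
    exact ⟨by linarith [hψ.2], by linarith [hψ.1]⟩
  have e1 : ∫ ψ in (-(Real.pi / 2))..(Real.pi / 2), h (-ψ) =
      ∫ ψ in (-(Real.pi / 2))..(Real.pi / 2), h ψ := by
    rw [intervalIntegral.integral_comp_neg, neg_neg]
  have e2 : ∫ φ in (0 : ℝ)..Real.pi, (Real.sin φ : ℂ) ^ (s - 1) * Complex.cos (b * φ) =
      ∫ ψ in (-(Real.pi / 2))..(Real.pi / 2), (Real.sin (ψ + Real.pi / 2) : ℂ) ^ (s - 1) *
        Complex.cos (b * ((ψ + Real.pi / 2 : ℝ) : ℂ)) := by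
    rw [intervalIntegral.integral_comp_add_right (fun φ : ℝ => (Real.sin φ : ℂ) ^ (s - 1) *
        Complex.cos (b * φ)), neg_add_cancel, add_halves]
  have e3 : ∀ ψ : ℝ, (Real.sin (ψ + Real.pi / 2) : ℂ) ^ (s - 1) *
        Complex.cos (b * ((ψ + Real.pi / 2 : ℝ) : ℂ)) =
      Complex.exp (b * (Real.pi / 2) * Complex.I) / 2 * h ψ +
        Complex.exp (-(b * (Real.pi / 2)) * Complex.I) / 2 * h (-ψ) := by
    intro ψ
    have h1 : Complex.exp (b * ((ψ + Real.pi / 2 : ℝ) : ℂ) * Complex.I) =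
        Complex.exp (b * (Real.pi / 2) * Complex.I) * Complex.exp (Complex.I * b * ψ) := by
      rw [← Complex.exp_add]
      push_cast
      ring_nf
    have h2 : Complex.exp (-(b * ((ψ + Real.pi / 2 : ℝ) : ℂ)) * Complex.I) =
        Complex.exp (-(b * (Real.pi / 2)) * Complex.I) *
          Complex.exp (Complex.I * b * ((-ψ : ℝ) : ℂ)) := by
      rw [← Complex.exp_add]
      push_cast
      ring_nf
    rw [Real.sin_add_pi_div_two, Complex.cos, h1, h2]
    simp only [hh, Real.cos_neg]
    ring
  rw [e2, ← integral_cos_cpow_mul_exp hs hμ]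
  simp_rw [e3]
  rw [intervalIntegral.integral_add (hint.const_mul _) (hint'.const_mul _),
    intervalIntegral.integral_const_mul, intervalIntegral.integral_const_mul, e1, Complex.cos]
  ring

/-! ### Beta-integral representation and the triple-angle substitution. -/

/-- The `k`-th coefficient of `₂F₁(α, 1 - α; 1/2; x)`. -/
noncomputable def reflectedCoeff (α : ℂ) (k : ℕ) : ℂ :=
  (ascPochhammer ℂ k).eval α * (ascPochhammer ℂ k).eval (1 - α) /
    ((ascPochhammer ℂ k).eval (1 / 2) * (k.factorial : ℂ))

theorem reflectedCoeff_zero (α : ℂ) : reflectedCoeff α 0 = 1 := by simp [reflectedCoeff]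

theorem reflectedCoeff_succ (α : ℂ) (k : ℕ) : reflectedCoeff α (k + 1) =
    (α + k) * (1 - α + k) / ((1 / 2 + k) * (k + 1)) * reflectedCoeff α k := by
  simp only [reflectedCoeff, ascPochhammer_succ_eval, Nat.factorial_succ]
  rw [div_mul_div_comm]
  push_cast
  congr 1 <;> ring

theorem tendsto_reflectedCoeff_ratio (α : ℂ) :
    Tendsto (fun k : ℕ => (α + k) * (1 - α + k) / ((1 / 2 + k) * (k + 1))) atTop (𝓝 1) := by
  have := (tendsto_natCast_add_div_natCast_add α (1 / 2)).mul
    (tendsto_natCast_add_div_natCast_add (1 - α) 1)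
  rw [mul_one] at this
  refine this.congr fun k => ?_
  rw [div_mul_div_comm]
  ring_nf

theorem summable_norm_reflectedCoeff_mul_pow (α : ℂ) :
    Summable fun k => ‖reflectedCoeff α k‖ * (3 / 4 : ℝ) ^ k :=
  summable_norm_mul_pow_of_ratio_tendsto_one (reflectedCoeff_succ α)
    (tendsto_reflectedCoeff_ratio α) (by norm_num) (by norm_num)

theorem betaIntegral_add_natCast_div {u v : ℂ} (hu : 0 < u.re) (hv : 0 < v.re) (k : ℕ) :
    Complex.betaIntegral (u + k) v / Complex.betaIntegral u v =
      (ascPochhammer ℂ k).eval u / (ascPochhammer ℂ k).eval (u + v) := by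
  have huv : 0 < (u + v).re := by simpa using add_pos hu hv
  have huk : 0 < (u + k).re := by
    simp only [Complex.add_re, Complex.natCast_re]
    positivity
  have hnn : ∀ {z : ℂ}, 0 < z.re → ∀ m : ℕ, z ≠ -m := fun hz m h => by
    rw [h] at hz
    simp only [Complex.neg_re, Complex.natCast_re] at hz
    exact absurd hz (by simp)
  rw [← Complex.Gamma_add_nat_div_Gamma_eq u (hnn hu),
    ← Complex.Gamma_add_nat_div_Gamma_eq (u + v) (hnn huv),
    Complex.betaIntegral_eq_Gamma_mul_div _ _ huk hv,
    Complex.betaIntegral_eq_Gamma_mul_div _ _ hu hv, show u + k + v = u + v + k by ring]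
  have h1 := Complex.Gamma_ne_zero_of_re_pos hu
  have h2 := Complex.Gamma_ne_zero_of_re_pos hv
  have h3 := Complex.Gamma_ne_zero_of_re_pos huv
  have h4 : Complex.Gamma (u + v + k) ≠ 0 := Complex.Gamma_ne_zero_of_re_pos (by
    simp only [Complex.add_re, Complex.natCast_re] at huv ⊢
    positivity)
  field_simp

theorem norm_ofReal_cpow_le_one {x : ℝ} (h0 : 0 ≤ x) (h1 : x ≤ 1) {z : ℂ} (hz : 0 < z.re) :
    ‖(x : ℂ) ^ z‖ ≤ 1 := by
  rw [Complex.norm_cpow_eq_rpow_re_of_nonneg h0 hz.ne']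
  exact Real.rpow_le_one h0 h1 hz.le

/-- Both real parts exceed 1, so the Beta weight is bounded by 1 and the series of coefficient norms
at 3/4 dominates the sum for every t. -/
theorem hasSum_mul_betaIntegral {u v : ℂ} (hu : 1 < u.re) (hv : 1 < v.re) (α : ℂ) :
    HasSum (fun k : ℕ => reflectedCoeff α k * (3 / 4) ^ k * Complex.betaIntegral (u + k) v)
      (∫ t in (0 : ℝ)..1, (t : ℂ) ^ (u - 1) * (1 - (t : ℂ)) ^ (v - 1) *
        ∑' k, reflectedCoeff α k * (3 / 4 * (t : ℂ)) ^ k) := by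
  simp only [Complex.betaIntegral, ← intervalIntegral.integral_const_mul]
  have hbd : ∀ t : ℝ, t ∈ Set.uIoc 0 1 → ∀ k : ℕ,
      (t : ℂ) ^ (u + k - 1) = (t : ℂ) ^ (u - 1) * (t : ℂ) ^ k := fun t ht k => by
    rw [Set.uIoc_of_le zero_le_one] at ht
    have : (t : ℂ) ≠ 0 := by exact_mod_cast ht.1.ne'
    rw [← Complex.cpow_natCast, ← Complex.cpow_add _ _ this]
    ring_nf
  refine intervalIntegral.hasSum_integral_of_dominated_convergence
    (fun k _ => ‖reflectedCoeff α k‖ * (3 / 4 : ℝ) ^ k) (fun k => ?_) (fun k => ?_)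
    (Eventually.of_forall fun t _ => summable_norm_reflectedCoeff_mul_pow α) (by simp)
    (Eventually.of_forall fun t ht => ?_)
  · have := (Complex.betaIntegral_convergent (u := u + k) (v := v)
      (by simp only [Complex.add_re, Complex.natCast_re]; positivity) (by positivity)).const_mul
      (reflectedCoeff α k * (3 / 4) ^ k)
    exact this.def'.aestronglyMeasurable
  · refine Eventually.of_forall fun t ht => ?_
    rw [hbd t ht]
    rw [Set.uIoc_of_le zero_le_one] at ht
    have h1 := norm_ofReal_cpow_le_one ht.1.le ht.2 (z := u - 1) (by simpa using hu)
    have h2 := norm_ofReal_cpow_le_one (x := 1 - t) (by linarith [ht.2]) (by linarith [ht.1])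
      (z := v - 1) (by simpa using hv)
    push_cast at h2
    have h3 : ‖(t : ℂ) ^ k‖ ≤ 1 := by
      rw [norm_pow, Complex.norm_real, Real.norm_of_nonneg ht.1.le]
      exact pow_le_one₀ ht.1.le ht.2
    simp only [norm_mul]
    have h4 : ‖((3 / 4 : ℂ)) ^ k‖ = (3 / 4 : ℝ) ^ k := by simp
    rw [h4]
    refine mul_le_of_le_one_right (by positivity) ?_
    exact mul_le_one₀ (mul_le_one₀ h1 (norm_nonneg _) h3) (norm_nonneg _) h2
  · have ht' := ht
    rw [Set.uIoc_of_le zero_le_one] at ht'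
    have hn : ‖(3 / 4 * (t : ℂ))‖ < 1 := by
      rw [norm_mul, Complex.norm_real, Real.norm_of_nonneg ht'.1.le]
      norm_num
      linarith [ht'.2]
    convert! (hasSum_mul_pow_of_ratio_tendsto_one (reflectedCoeff_succ α)
      (tendsto_reflectedCoeff_ratio α) hn).mul_left
      ((t : ℂ) ^ (u - 1) * (1 - (t : ℂ)) ^ (v - 1)) using 2 with k
    rw [hbd t ht, mul_pow]
    ring

/-- With t = (4/3) sin² θ, the sine in dt and t^(a-1) combine to sin^(2a-1) θ, and sin θ · (1 - t) =
sin(3θ)/3 absorbs (1-t)^(2a-1). The cosine in dt is the one that `hG` consumes. All bases are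
nonnegative reals for θ ≤ π/3, which justifies splitting the powers. -/
theorem sin_pow_substitution {a m G : ℂ} (ha : 1 < a.re) {θ : ℝ}
    (hθ : θ ∈ Set.Icc 0 (Real.pi / 3)) (hG : Complex.cos θ * G = Complex.cos (m * θ)) :
    ((8 / 3 * (Real.sin θ * Real.cos θ) : ℝ) : ℂ) *
      (((4 / 3 * Real.sin θ ^ 2 : ℝ) : ℂ) ^ (a - 1) *
        (1 - ((4 / 3 * Real.sin θ ^ 2 : ℝ) : ℂ)) ^ (2 * a - 1) * G) =
      8 / 3 * (4 / 3) ^ (a - 1) * 3 ^ (1 - 2 * a) *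
        ((Real.sin (3 * θ) : ℂ) ^ (2 * a - 1) * Complex.cos (m * θ)) := by
  rcases hθ.1.eq_or_lt with h | h
  · have : 2 * a - 1 ≠ 0 := fun h => by
      have := congrArg Complex.re h
      simp at this
      linarith
    simp [← h, this]
  have hS : 0 < Real.sin θ := Real.sin_pos_of_pos_of_lt_pi h (by linarith [hθ.2, Real.pi_pos])
  have hT : 0 ≤ Real.sin (3 * θ) :=
    Real.sin_nonneg_of_nonneg_of_le_pi (by linarith) (by linarith [hθ.2])
  have hTS : Real.sin (3 * θ) = 3 * (Real.sin θ * (1 - 4 / 3 * Real.sin θ ^ 2)) := by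
    rw [Real.sin_three_mul]
    ring
  have h1 : 0 ≤ 1 - 4 / 3 * Real.sin θ ^ 2 := by
    by_contra! hneg
    nlinarith [mul_neg_of_pos_of_neg hS hneg]
  have hS0 : (Real.sin θ : ℂ) ≠ 0 := by exact_mod_cast hS.ne'
  have e1 : ((4 / 3 * Real.sin θ ^ 2 : ℝ) : ℂ) ^ (a - 1) =
      (4 / 3) ^ (a - 1) * ((Real.sin θ : ℂ) ^ (a - 1) * (Real.sin θ : ℂ) ^ (a - 1)) := by
    rw [Complex.ofReal_mul, Complex.mul_cpow_ofReal_nonneg (by norm_num) (sq_nonneg _), sq,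
      Complex.ofReal_mul, Complex.mul_cpow_ofReal_nonneg hS.le hS.le]
    norm_num
  have e2 : (Real.sin θ : ℂ) * ((Real.sin θ : ℂ) ^ (a - 1) * (Real.sin θ : ℂ) ^ (a - 1)) =
      (Real.sin θ : ℂ) ^ (2 * a - 1) := by
    rw [← Complex.cpow_add _ _ hS0]
    nth_rewrite 1 [← Complex.cpow_one (Real.sin θ : ℂ)]
    rw [← Complex.cpow_add _ _ hS0]
    ring_nf
  have e3 : (Real.sin (3 * θ) : ℂ) ^ (2 * a - 1) = 3 ^ (2 * a - 1) *
      ((Real.sin θ : ℂ) ^ (2 * a - 1) *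
        (1 - ((4 / 3 * Real.sin θ ^ 2 : ℝ) : ℂ)) ^ (2 * a - 1)) := by
    rw [hTS, Complex.ofReal_mul, Complex.mul_cpow_ofReal_nonneg (by norm_num) (by positivity),
      Complex.ofReal_mul, Complex.mul_cpow_ofReal_nonneg hS.le h1]
    norm_num
  have e4 : (3 : ℂ) ^ (1 - 2 * a) * 3 ^ (2 * a - 1) = 1 := by
    rw [← Complex.cpow_add _ _ three_ne_zero]
    simp
  rw [e3, e1, ← e2, ← hG]
  set X := (1 - ((4 / 3 * Real.sin θ ^ 2 : ℝ) : ℂ)) ^ (2 * a - 1)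
  set Y := (Real.sin θ : ℂ) ^ (a - 1)
  rw [Complex.ofReal_mul, Complex.ofReal_mul, Complex.ofReal_cos]
  push_cast
  linear_combination (-(8 / 3 * (4 / 3) ^ (a - 1) * (Complex.sin θ * (Y * Y) * X) *
    (Complex.cos θ * G))) * e4

theorem integral_mul_tsum_reflectedCoeff {a : ℂ} (ha : 1 < a.re) :
    ∫ t in (0 : ℝ)..1, (t : ℂ) ^ (a - 1) * (1 - (t : ℂ)) ^ (2 * a - 1) *
        ∑' k, reflectedCoeff (3 * a - 1 / 2) k * (3 / 4 * (t : ℂ)) ^ k =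
      8 / 3 * (4 / 3) ^ (a - 1) * 3 ^ (1 - 2 * a) * (1 / 3 * ∫ φ in (0 : ℝ)..Real.pi,
        (Real.sin φ : ℂ) ^ (2 * a - 1) * Complex.cos ((2 * a - 1 + 1 / 3) * φ)) := by
  have hre : 0 < (2 * a - 1).re := by
    simp
    linarith
  set w : ℝ → ℂ := fun t => (t : ℂ) ^ (a - 1) * (1 - (t : ℂ)) ^ (2 * a - 1) *
        ∑' k, reflectedCoeff (3 * a - 1 / 2) k * (3 / 4 * (t : ℂ)) ^ k with hw
  have hd : ∀ x ∈ Set.uIcc 0 (Real.pi / 3), HasDerivAt (fun x : ℝ => 4 / 3 * Real.sin x ^ 2)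
      (8 / 3 * (Real.sin x * Real.cos x)) x := fun x _ => by
    convert! ((Real.hasDerivAt_sin x).fun_pow 2).const_mul (4 / 3 : ℝ) using 1
    ring
  have hsin3 : Real.sin (Real.pi / 3) ^ 2 = 3 / 4 := by
    rw [Real.sin_pi_div_three, div_pow, Real.sq_sqrt (by norm_num)]
    norm_num
  have key := intervalIntegral.integral_deriv_smul_comp' hd (by fun_prop) (g := w) ?_
  · rw [hsin3, Real.sin_zero, show (4 / 3 * (3 / 4) : ℝ) = 1 by norm_num,
      show (4 / 3 * 0 ^ 2 : ℝ) = 0 by norm_num] at key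
    have h3 := intervalIntegral.integral_comp_mul_left (a := 0) (b := Real.pi / 3)
      (fun φ : ℝ => (Real.sin φ : ℂ) ^ (2 * a - 1) * Complex.cos ((2 * a - 1 + 1 / 3) * φ))
      (three_ne_zero : (3 : ℝ) ≠ 0)
    rw [mul_zero, show 3 * (Real.pi / 3) = Real.pi by ring, Complex.real_smul] at h3
    rw [show ((3⁻¹ : ℝ) : ℂ) = 1 / 3 by push_cast; norm_num] at h3
    rw [← key, ← h3,
      ← intervalIntegral.integral_const_mul]
    refine intervalIntegral.integral_congr fun θ hθ => ?_
    rw [Set.uIcc_of_le (by positivity)] at hθ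
    have hcos := cos_mul_tsum_sin_sq (reflectedCoeff_zero (3 * a - 1 / 2))
      (reflectedCoeff_succ (3 * a - 1 / 2)) hθ.1 (by linarith [hθ.2, Real.pi_pos])
    have := sin_pow_substitution ha hθ hcos
    simp only [Function.comp, hw, Complex.real_smul]
    have e1 : (3 / 4 * ((4 / 3 * Real.sin θ ^ 2 : ℝ) : ℂ)) = Complex.sin θ ^ 2 := by
      push_cast
      ring
    rw [e1, this]
    congr 3
    push_cast
    ring
  · rintro _ ⟨x, hx, rfl⟩
    rw [Set.uIcc_of_le (by positivity)] at hx
    have hs0 : 0 ≤ Real.sin x :=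
      Real.sin_nonneg_of_nonneg_of_le_pi hx.1 (by linarith [hx.2, Real.pi_pos])
    have hs1 : Real.sin x ≤ Real.sin (Real.pi / 3) :=
      Real.sin_le_sin_of_le_of_le_pi_div_two (by linarith [hx.1, Real.pi_pos])
        (by linarith [Real.pi_pos]) hx.2
    have hs2 : Real.sin x ^ 2 ≤ 3 / 4 := hsin3 ▸ pow_le_pow_left₀ hs0 hs1 2
    obtain ⟨t, ht⟩ : ∃ t, t = 4 / 3 * Real.sin x ^ 2 := ⟨_, rfl⟩
    have ht0 : 0 ≤ t := by rw [ht]; positivity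
    have ht1 : t ≤ 1 := by linarith
    change ContinuousWithinAt w _ (4 / 3 * Real.sin x ^ 2)
    rw [← ht]
    have c1 := Complex.continuousAt_cpow_const_of_re_pos (z := (t : ℂ)) (w := a - 1)
      (Or.inl (by simpa using ht0)) (by simpa using ha)
    have c2 := Complex.continuousAt_cpow_const_of_re_pos (z := 1 - (t : ℂ)) (w := 2 * a - 1)
      (Or.inl (by simpa using ht1)) hre
    have c3 := (hasDerivAt_tsum_mul_pow (reflectedCoeff_succ (3 * a - 1 / 2))
      (tendsto_reflectedCoeff_ratio (3 * a - 1 / 2)) (x := 3 / 4 * (t : ℂ)) (by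
        rw [norm_mul, Complex.norm_real, Real.norm_of_nonneg ht0]
        norm_num
        linarith)).continuousAt
    have f1 : ContinuousAt (fun t : ℝ => (t : ℂ)) t := by fun_prop
    have f2 : ContinuousAt (fun t : ℝ => 1 - (t : ℂ)) t := by fun_prop
    have f3 : ContinuousAt (fun t : ℝ => 3 / 4 * (t : ℂ)) t := by fun_prop
    exact (((ContinuousAt.comp (f := fun t : ℝ => (t : ℂ)) c1 f1).mul
      (ContinuousAt.comp (f := fun t : ℝ => 1 - (t : ℂ)) c2 f2)).mul
      (ContinuousAt.comp (f := fun t : ℝ => 3 / 4 * (t : ℂ)) c3 f3)).continuousWithinAt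

theorem cpow_factor_identity (a : ℂ) :
    8 / 3 * (4 / 3 : ℂ) ^ (a - 1) * 3 ^ (1 - 2 * a) * 2 ^ (1 - 2 * a) * 3 ^ (3 * a) = 12 := by
  have hP : (2 : ℂ) ^ a ≠ 0 := by simp
  have hQ : (3 : ℂ) ^ a ≠ 0 := by simp
  have e1 : (4 / 3 : ℂ) ^ (a - 1) * 3 ^ (a - 1) = 2 ^ (a - 1) * 2 ^ (a - 1) := by
    have h1 := Complex.mul_cpow_ofReal_nonneg (a := 4 / 3) (b := 3) (by norm_num) (by norm_num)
      (a - 1)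
    have h2 := Complex.mul_cpow_ofReal_nonneg (a := 2) (b := 2) (by norm_num) (by norm_num) (a - 1)
    push_cast at h1 h2
    rw [← h1, ← h2]
    norm_num
  have e2 : (3 : ℂ) ^ (3 * a) = (3 ^ a) ^ 3 := by
    rw [← Complex.cpow_nat_mul]
    norm_num
  have e3 : ∀ x : ℂ, x ≠ 0 → x ^ (1 - 2 * a) = x / (x ^ a) ^ 2 := fun x hx => by
    rw [Complex.cpow_sub _ _ hx, Complex.cpow_one, ← Complex.cpow_nat_mul]
    norm_num
  rw [Complex.cpow_sub _ _ two_ne_zero, Complex.cpow_sub _ _ three_ne_zero, Complex.cpow_one,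
    Complex.cpow_one] at e1
  rw [e2, e3 3 three_ne_zero, e3 2 two_ne_zero]
  have e4 : (4 / 3 : ℂ) ^ (a - 1) = 3 / 4 * (2 ^ a) ^ 2 / 3 ^ a := by
    rw [eq_div_iff hQ]
    linear_combination 3 * e1
  rw [e4]
  field_simp
  norm_num

theorem hypergeometric3F2_eq_gammaQuotientRHS_of_one_lt_re {a : ℂ} (ha : 1 < a.re) :
    hypergeometric3F2 a (3 * a - 1 / 2) (3 / 2 - 3 * a) (3 * a) (1 / 2) (3 / 4) =
      gammaQuotientRHS a := by
  have h0 : 0 < a.re := by linarith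
  have h2 : 1 < (2 * a).re := by
    simp
    linarith
  have h2' : 0 < (2 * a).re := by linarith
  have h3' : 0 < (a + 2 * a).re := by
    rw [Complex.add_re]
    positivity
  have hsum := (hasSum_mul_betaIntegral ha h2 (3 * a - 1 / 2)).div_const
    (Complex.betaIntegral a (2 * a))
  have hterm : ∀ k : ℕ, reflectedCoeff (3 * a - 1 / 2) k * (3 / 4) ^ k *
      Complex.betaIntegral (a + k) (2 * a) / Complex.betaIntegral a (2 * a) =
      hypergeometric3F2Term a (3 * a - 1 / 2) (3 / 2 - 3 * a) (3 * a) (1 / 2) (3 / 4) k := by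
    intro k
    rw [mul_div_assoc, betaIntegral_add_natCast_div h0 h2', hypergeometric3F2Term, reflectedCoeff,
      show a + 2 * a = 3 * a by ring, show 1 - (3 * a - 1 / 2) = 3 / 2 - 3 * a by ring]
    rw [mul_right_comm, div_mul_div_comm]
    ring_nf
  simp_rw [hterm] at hsum
  have hs := integral_sin_cpow_mul_cos (s := 2 * a) (μ := 1 / 3) h2 (by norm_num)
  rw [hypergeometric3F2, hsum.tsum_eq, integral_mul_tsum_reflectedCoeff ha, hs,
    show (1 / 3 / 2 : ℂ) = 1 / 6 by norm_num,
    show (Real.pi * (1 / 3) / 2 : ℂ) = ((Real.pi / 6 : ℝ) : ℂ) by push_cast; ring,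
    ← Complex.ofReal_sin, Real.sin_pi_div_six,
    show (2 * a - 1 + 1 / 3) * (Real.pi / 2 : ℂ) =
      (Real.pi / 6 + Real.pi * a) - Real.pi / 2 by ring,
    Complex.cos_sub_pi_div_two,
    Complex.betaIntegral_eq_Gamma_mul_div _ _ (by norm_num) h2',
    Complex.betaIntegral_eq_Gamma_mul_div _ _ h0 h2', gammaQuotientRHS,
    show a + 2 * a = 3 * a by ring, show 1 / 6 + 2 * a = 2 * a + 1 / 6 by ring]
  have g1 := Complex.Gamma_ne_zero_of_re_pos h0
  have g2 := Complex.Gamma_ne_zero_of_re_pos h2'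
  have g3 := Complex.Gamma_ne_zero_of_re_pos h3'
  rw [show a + 2 * a = 3 * a by ring] at g3
  have g4 : Complex.Gamma (2 * a + 1 / 6) ≠ 0 := Complex.Gamma_ne_zero_of_re_pos (by
    rw [Complex.add_re]
    norm_num
    linarith)
  have hQ : (3 : ℂ) ^ (3 * a) ≠ 0 := by simp
  have hpow := cpow_factor_identity a
  rw [← eq_div_iff hQ] at hpow
  set X := 8 / 3 * (4 / 3 : ℂ) ^ (a - 1) * 3 ^ (1 - 2 * a)
  set S := Complex.sin (Real.pi / 6 + Real.pi * a)
  set Γ₀ := Complex.Gamma (1 / 6)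
  set Γ₄ := Complex.Gamma (2 * a + 1 / 6)
  set Γ₁ := Complex.Gamma a
  set Γ₂ := Complex.Gamma (2 * a)
  set Γ₃ := Complex.Gamma (3 * a)
  -- Gathers the powers of 2 and 3 into one factor, which `hpow` evaluates; 1/6 is sin(π/6) = 1/2
  -- times the 1/3 from φ = 3θ.
  trans (X * 2 ^ (1 - 2 * a)) * (1 / 6 * S * Γ₀ * Γ₃ / (Γ₄ * Γ₁))
  · push_cast
    field_simp
    ring
  · rw [hpow]
    field_simp
    ring

/-! ### Analyticity in the parameter and the identity theorem. -/

/-- `Complex.Gamma` takes the value 0 exactly at its poles, so the excluded points are the zeros of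
the entire function 1/Γ(3a); openness follows at once. -/
theorem mem_regularParams_iff {a : ℂ} : a ∈ regularParams ↔ (Complex.Gamma (3 * a))⁻¹ ≠ 0 := by
  rw [ne_eq, inv_eq_zero, Complex.Gamma_eq_zero_iff, regularParams, Set.mem_ofPred_eq, not_exists]

theorem isOpen_regularParams : IsOpen regularParams := by
  have h : regularParams = (fun a : ℂ => (Complex.Gamma (3 * a))⁻¹) ⁻¹' {0}ᶜ := by
    ext a
    exact mem_regularParams_iff
  rw [h]
  refine isOpen_compl_singleton.preimage ?_
  exact Complex.differentiable_one_div_Gamma.continuous.comp (continuous_const.mul continuous_id)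

theorem isPreconnected_regularParams : IsPreconnected regularParams := by
  have hc : (regularParamsᶜ).Countable := by
    refine (Set.countable_range fun m : ℕ => -(m : ℂ) / 3).mono fun a ha => ?_
    simp only [regularParams, Set.mem_compl_iff, Set.mem_ofPred_eq, not_forall, not_not] at ha
    obtain ⟨m, hm⟩ := ha
    refine ⟨m, ?_⟩
    simp only
    rw [← hm]
    ring
  have := hc.isConnected_compl_of_one_lt_rank (E := ℂ) (by simp)
  rw [compl_compl] at this
  exact this.isPreconnected

theorem mem_regularParams_of_re_pos {a : ℂ} (ha : 0 < a.re) : a ∈ regularParams := by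
  rw [mem_regularParams_iff]
  refine inv_ne_zero (Complex.Gamma_ne_zero_of_re_pos ?_)
  simpa using ha

theorem differentiableOn_gammaQuotientRHS : DifferentiableOn ℂ gammaQuotientRHS regularParams := by
  intro a ha
  have h1 : DifferentiableAt ℂ (fun a : ℂ => Complex.Gamma (3 * a)) a :=
    DifferentiableAt.comp (f := fun a : ℂ => 3 * a) a (Complex.differentiableAt_Gamma _ ha)
      (by fun_prop)
  have h2 : DifferentiableAt ℂ (fun a : ℂ => (Complex.Gamma (2 * a + 1 / 6))⁻¹) a :=
    DifferentiableAt.comp (f := fun a : ℂ => 2 * a + 1 / 6) a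
      Complex.differentiable_one_div_Gamma.differentiableAt (by fun_prop)
  have h3 : DifferentiableAt ℂ (fun a : ℂ => (Complex.Gamma a)⁻¹) a :=
    Complex.differentiable_one_div_Gamma.differentiableAt
  have h4 : DifferentiableAt ℂ (fun a : ℂ => ((3 : ℂ) ^ (3 * a))⁻¹) a :=
    DifferentiableAt.fun_inv (DifferentiableAt.const_cpow (by fun_prop) (Or.inl three_ne_zero))
      (by simp)
  have h5 : DifferentiableAt ℂ (fun a : ℂ => Complex.sin (Real.pi / 6 + Real.pi * a)) a := by
    fun_prop
  have h6 := ((((h1.const_mul (2 * Complex.Gamma (1 / 6))).mul h5).mul h4).mul h2).mul h3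
  refine (h6.congr_of_eventuallyEq (Eventually.of_forall fun z => ?_)).differentiableWithinAt
  simp only [gammaQuotientRHS, Pi.mul_apply, div_eq_mul_inv, mul_inv]
  ring

theorem hypergeometric3F2Term_succ (a b c d e x : ℂ) (k : ℕ) :
    hypergeometric3F2Term a b c d e x (k + 1) =
      ((a + k) * (b + k) * (c + k) / ((d + k) * (e + k) * (k + 1)) * x) *
        hypergeometric3F2Term a b c d e x k := by
  simp only [hypergeometric3F2Term, ascPochhammer_succ_eval, Nat.factorial_succ, pow_succ]
  simp only [div_eq_mul_inv, mul_inv]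
  push_cast
  simp only [mul_inv]
  ring

theorem differentiableOn_hypergeometric3F2Term (k : ℕ) : DifferentiableOn ℂ (fun a : ℂ =>
    hypergeometric3F2Term a (3 * a - 1 / 2) (3 / 2 - 3 * a) (3 * a) (1 / 2) (3 / 4) k)
      regularParams := by
  intro a ha
  have hp : Differentiable ℂ fun z : ℂ => (ascPochhammer ℂ k).eval z :=
    (ascPochhammer ℂ k).differentiable
  have hne : ∀ {z : ℂ}, (∀ m : ℕ, z ≠ -m) → (ascPochhammer ℂ k).eval z ≠ 0 := fun {z} hz => by
    rw [ne_eq, ascPochhammer_eval_eq_zero_iff]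
    rintro ⟨m, -, hm⟩
    exact hz m (by rw [hm, neg_neg])
  have h1 : DifferentiableAt ℂ (fun a : ℂ => (ascPochhammer ℂ k).eval (3 * a - 1 / 2)) a :=
    (hp.comp (by fun_prop : Differentiable ℂ fun a : ℂ => 3 * a - 1 / 2)) a
  have h2 : DifferentiableAt ℂ (fun a : ℂ => (ascPochhammer ℂ k).eval (3 / 2 - 3 * a)) a :=
    (hp.comp (by fun_prop : Differentiable ℂ fun a : ℂ => 3 / 2 - 3 * a)) a
  have h3 : DifferentiableAt ℂ (fun a : ℂ => (ascPochhammer ℂ k).eval (3 * a)) a :=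
    (hp.comp (by fun_prop : Differentiable ℂ fun a : ℂ => 3 * a)) a
  have hhalf : (ascPochhammer ℂ k).eval (1 / 2) ≠ 0 := hne fun m hm => by
    have h := congrArg Complex.re hm
    norm_num at h
    linarith [(Nat.cast_nonneg m : (0 : ℝ) ≤ m)]
  simp only [hypergeometric3F2Term]
  exact (((((hp a).mul h1).mul h2).div ((h3.mul_const _).mul_const _)
    (mul_ne_zero (mul_ne_zero (hne ha) hhalf) (by exact_mod_cast k.factorial_ne_zero))).mul_const
    _).differentiableWithinAt

/-- The term ratio tends to 3/4 uniformly on the disc; 7/8 is any number strictly between 3/4 and 1.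
-/
theorem exists_norm_ratio_le (R : ℝ) (hR : 0 ≤ R) : ∃ N : ℕ, ∀ k ≥ N, ∀ a : ℂ, ‖a‖ ≤ R →
    ‖(a + k) * (3 * a - 1 / 2 + k) * (3 / 2 - 3 * a + k) /
      ((3 * a + k) * (1 / 2 + k) * (k + 1)) * (3 / 4)‖ ≤ 7 / 8 := by
  have hlim : Tendsto (fun k : ℕ => ((k : ℝ) + R) / (k + -(3 * R)) *
      (((k : ℝ) + (3 * R + 1 / 2)) / (k + 1 / 2)) * (((k : ℝ) + (3 * R + 3 / 2)) / (k + 1)) *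
        (3 / 4)) atTop (𝓝 (3 / 4)) := by
    simpa using (((tendsto_natCast_add_div_natCast_add R (-(3 * R))).mul
      (tendsto_natCast_add_div_natCast_add (3 * R + 1 / 2) (1 / 2))).mul
      (tendsto_natCast_add_div_natCast_add (3 * R + 3 / 2) 1)).mul_const (3 / 4)
  -- Beyond this index |3a + k| ≥ k - 3R > 0, so the denominator can be bounded below.
  obtain ⟨M, hM⟩ := exists_nat_gt (3 * R)
  obtain ⟨N, hN⟩ := eventually_atTop.1
    (hlim.eventually (gt_mem_nhds (by norm_num : (3 / 4 : ℝ) < 7 / 8)))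
  refine ⟨max M N, fun k hk a ha => le_trans ?_ (hN k (le_of_max_le_right hk)).le⟩
  have hkM : 3 * R < k := hM.trans_le (by exact_mod_cast le_of_max_le_left hk)
  have n1 : ‖a + k‖ ≤ k + R := by
    refine (norm_add_le _ _).trans ?_
    rw [Complex.norm_natCast]
    linarith
  have h3a : ‖3 * a‖ ≤ 3 * R := by
    rw [norm_mul]
    norm_num
    exact ha
  have n2 : ‖3 * a - 1 / 2 + k‖ ≤ k + (3 * R + 1 / 2) := by
    refine (norm_add_le _ _).trans ?_
    have := norm_sub_le (3 * a) (1 / 2)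
    rw [Complex.norm_natCast]
    norm_num at this h3a ⊢
    linarith
  have n3 : ‖3 / 2 - 3 * a + k‖ ≤ k + (3 * R + 3 / 2) := by
    refine (norm_add_le _ _).trans ?_
    have := norm_sub_le (3 / 2) (3 * a)
    rw [Complex.norm_natCast]
    norm_num at this h3a ⊢
    linarith
  have d1 : (k : ℝ) + -(3 * R) ≤ ‖3 * a + k‖ := by
    have := norm_sub_le (3 * a + k) (3 * a)
    rw [add_sub_cancel_left, Complex.norm_natCast] at this
    linarith
  have d2 : ‖(1 / 2 + k : ℂ)‖ = k + 1 / 2 := by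
    rw [show (1 / 2 + k : ℂ) = ((k + 1 / 2 : ℝ) : ℂ) by push_cast; ring, Complex.norm_real,
      Real.norm_of_nonneg (by positivity)]
  have d3 : ‖(k + 1 : ℂ)‖ = k + 1 := by
    rw [show (k + 1 : ℂ) = ((k + 1 : ℝ) : ℂ) by push_cast; ring, Complex.norm_real,
      Real.norm_of_nonneg (by positivity)]
  have hpos : 0 < (k : ℝ) + -(3 * R) := by linarith
  rw [norm_mul, norm_div, norm_mul, norm_mul, norm_mul, norm_mul, d2, d3, div_mul_div_comm,
    div_mul_div_comm, show ‖(3 / 4 : ℂ)‖ = 3 / 4 by norm_num]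
  gcongr

theorem exists_norm_hypergeometric3F2Term_le {a₀ : ℂ} (ha₀ : a₀ ∈ regularParams) :
    ∃ U ∈ 𝓝 a₀, ∃ C : ℝ, IsOpen U ∧ U ⊆ regularParams ∧ ∀ (k : ℕ), ∀ a ∈ U,
      ‖hypergeometric3F2Term a (3 * a - 1 / 2) (3 / 2 - 3 * a) (3 * a) (1 / 2) (3 / 4) k‖ ≤
        C * (7 / 8) ^ k := by
  set T : ℕ → ℂ → ℂ := fun k a =>
    hypergeometric3F2Term a (3 * a - 1 / 2) (3 / 2 - 3 * a) (3 * a) (1 / 2) (3 / 4) k with hT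
  obtain ⟨N, hN⟩ := exists_norm_ratio_le (‖a₀‖ + 1) (by positivity)
  have hcont : ∀ k, ContinuousAt (T k) a₀ := fun k =>
    ((differentiableOn_hypergeometric3F2Term k).differentiableAt
      (isOpen_regularParams.mem_nhds ha₀)).continuousAt
  have hev : ∀ᶠ a in 𝓝 a₀, (∀ k ∈ Finset.range (N + 1), ‖T k a‖ ≤ ‖T k a₀‖ + 1) ∧
      ‖a‖ ≤ ‖a₀‖ + 1 ∧ a ∈ regularParams := by
    refine Eventually.and ((Finset.eventually_all _).2 fun k _ => ?_) (Eventually.and ?_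
      (isOpen_regularParams.mem_nhds ha₀))
    · exact ((hcont k).norm.eventually (gt_mem_nhds (lt_add_one _))).mono fun _ h => h.le
    · exact (continuous_norm.continuousAt.eventually (gt_mem_nhds (lt_add_one ‖a₀‖))).mono
        fun _ h => h.le
  obtain ⟨U, hU, hUo, haU⟩ := eventually_nhds_iff.1 hev
  -- Bounds each of the terms up to index N near `a₀`, by continuity. The factor (8/7)^N in the
  -- constant below makes the geometric bound at least S for k ≤ N; later terms follow by the ratio
  -- bound.
  set S := ∑ k ∈ Finset.range (N + 1), (‖T k a₀‖ + 1) with hS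
  have hS0 : 0 ≤ S := Finset.sum_nonneg fun k _ => by positivity
  refine ⟨U, hUo.mem_nhds haU, S * (8 / 7) ^ N, hUo, fun a ha => (hU a ha).2.2, fun k a ha => ?_⟩
  have small : ∀ k ≤ N, ‖T k a‖ ≤ S * (8 / 7) ^ N * (7 / 8) ^ k := fun k hk => by
    have hmem : k ∈ Finset.range (N + 1) := Finset.mem_range.2 (by omega)
    have h1 : ‖T k a‖ ≤ S := ((hU a ha).1 k hmem).trans
      (Finset.single_le_sum (f := fun k => ‖T k a₀‖ + 1) (fun _ _ => by positivity) hmem)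
    have h2 : (1 : ℝ) ≤ (8 / 7) ^ N * (7 / 8) ^ k := by
      calc (1 : ℝ) = (8 / 7) ^ N * (7 / 8) ^ N := by rw [← mul_pow]; norm_num
        _ ≤ _ := mul_le_mul_of_nonneg_left
          (pow_le_pow_of_le_one (by norm_num) (by norm_num) hk) (by positivity)
    rw [mul_assoc]
    exact h1.trans (le_mul_of_one_le_right hS0 h2)
  rcases le_total k N with hk | hk
  · exact small k hk
  · change ‖T k a‖ ≤ _
    induction k, hk using Nat.le_induction with
    | base => exact small N le_rfl
    | succ k hk ih =>
      have hr := hN k hk a (hU a ha).2.1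
      simp only [hT] at ih ⊢
      rw [hypergeometric3F2Term_succ, norm_mul, pow_succ, ← mul_assoc, mul_comm]
      exact mul_le_mul ih hr (norm_nonneg _) (by positivity)

theorem summable_norm_hypergeometric3F2Term {a : ℂ} (ha : a ∈ regularParams) :
    Summable fun k : ℕ =>
      ‖hypergeometric3F2Term a (3 * a - 1 / 2) (3 / 2 - 3 * a) (3 * a) (1 / 2) (3 / 4) k‖ := by
  obtain ⟨U, hU, C, -, -, hC⟩ := exists_norm_hypergeometric3F2Term_le ha
  exact Summable.of_nonneg_of_le (fun _ => norm_nonneg _) (fun k => hC k a (mem_of_mem_nhds hU))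
    ((summable_geometric_of_lt_one (by norm_num) (by norm_num)).mul_left C)

theorem analyticOnNhd_hypergeometric3F2 : AnalyticOnNhd ℂ (fun a : ℂ =>
    hypergeometric3F2 a (3 * a - 1 / 2) (3 / 2 - 3 * a) (3 * a) (1 / 2) (3 / 4)) regularParams := by
  refine DifferentiableOn.analyticOnNhd (fun a ha => ?_) isOpen_regularParams
  obtain ⟨U, hU, C, hUo, hUs, hC⟩ := exists_norm_hypergeometric3F2Term_le ha
  have hd := Complex.differentiableOn_tsum_of_summable_norm
    ((summable_geometric_of_lt_one (by norm_num : (0 : ℝ) ≤ 7 / 8) (by norm_num)).mul_left C)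
    (fun k => (differentiableOn_hypergeometric3F2Term k).mono hUs) hUo hC
  exact (hd.differentiableAt hU).differentiableWithinAt

theorem analyticOnNhd_gammaQuotientRHS : AnalyticOnNhd ℂ gammaQuotientRHS regularParams :=
  differentiableOn_gammaQuotientRHS.analyticOnNhd isOpen_regularParams

theorem hypergeometric3F2_eq_gammaQuotientRHS {a : ℂ} (ha : a ∈ regularParams) :
    hypergeometric3F2 a (3 * a - 1 / 2) (3 / 2 - 3 * a) (3 * a) (1 / 2) (3 / 4) =
      gammaQuotientRHS a := by
  have h2 : (2 : ℂ) ∈ regularParams := mem_regularParams_of_re_pos (by norm_num)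
  refine analyticOnNhd_hypergeometric3F2.eqOn_of_preconnected_of_eventuallyEq
    analyticOnNhd_gammaQuotientRHS isPreconnected_regularParams h2 ?_ ha
  -- The base point 2 lies in the open half-plane Re a > 1, where the identity is already known.
  filter_upwards [(isOpen_lt continuous_const Complex.continuous_re).mem_nhds
    (show (1 : ℝ) < (2 : ℂ).re by norm_num)] with z hz
  exact hypergeometric3F2_eq_gammaQuotientRHS_of_one_lt_re hz

/-! ### Limits at the nonpositive integers. -/

theorem eventually_mem_regularParams (n : ℕ) :
    ∀ᶠ a in 𝓝[≠] (-(n : ℂ)), a ∈ regularParams ∧ 0 < (1 - 3 * a).re ∧ 0 < (1 - a).re := by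
  rw [eventually_nhdsWithin_iff]
  filter_upwards [Metric.ball_mem_nhds (-(n : ℂ)) (by norm_num : (0 : ℝ) < 1 / 3)] with a ha hne
  rw [Metric.mem_ball, dist_eq_norm, sub_neg_eq_add] at ha
  have hn : (0 : ℝ) ≤ n := n.cast_nonneg
  have hre : a.re + n < 1 / 3 := by
    have := (Complex.re_le_norm (a + n)).trans_lt ha
    simpa using this
  refine ⟨fun m hm => hne ?_, by simp; linarith, by simp; linarith⟩
  -- Excluded points are spaced 1/3 apart: inside the radius 1/3 this integer has absolute value
  -- below 1, hence is 0 and a = -n.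
  have h1 : ((3 * n - m : ℤ) : ℂ) = 3 * (a + n) := by
    push_cast
    rw [mul_add, hm]
    ring
  have h2 : |((3 * n - m : ℤ) : ℝ)| < 1 := by
    rw [← Complex.norm_intCast, h1, norm_mul]
    norm_num
    linarith
  have h3 : (3 * n - m : ℤ) = 0 := by
    rw [← Int.abs_lt_one_iff]
    exact_mod_cast h2
  rw [h3] at h1
  simp only [Int.cast_zero, zero_eq_mul, OfNat.ofNat_ne_zero, false_or] at h1
  simpa using eq_neg_of_add_eq_zero_left h1

/-- Reflection at a and at 3a gives the factor sin(πa)/sin(3πa), and sin 3x = sin x · (3 - 4 sin² x)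
cancels the common zero. At a = -n the remaining denominator factor is 3, so the singularity is
visibly removable. -/
theorem Gamma_three_mul_div_Gamma {a : ℂ} (ha : a ∈ regularParams) (h3 : 0 < (1 - 3 * a).re)
    (h1 : 0 < (1 - a).re) :
    Complex.Gamma (3 * a) / Complex.Gamma a = Complex.Gamma (1 - a) /
      (Complex.Gamma (1 - 3 * a) * (3 - 4 * Complex.sin (Real.pi * a) ^ 2)) := by
  have g1 := Complex.Gamma_ne_zero ha
  have g2 : Complex.Gamma a ≠ 0 := Complex.Gamma_ne_zero fun m hm => ha (3 * m) (by
    rw [hm]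
    push_cast
    ring)
  have g3 := Complex.Gamma_ne_zero_of_re_pos h3
  have g4 := Complex.Gamma_ne_zero_of_re_pos h1
  have r1 := Complex.Gamma_mul_Gamma_one_sub a
  have r3 := Complex.Gamma_mul_Gamma_one_sub (3 * a)
  have s1 : Complex.sin (Real.pi * a) ≠ 0 := fun h => by
    rw [h, div_zero] at r1
    exact mul_ne_zero g2 g4 r1
  have s3 : Complex.sin (Real.pi * (3 * a)) ≠ 0 := fun h => by
    rw [h, div_zero] at r3
    exact mul_ne_zero g1 g3 r3
  have e : Complex.sin (Real.pi * (3 * a)) =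
      Complex.sin (Real.pi * a) * (3 - 4 * Complex.sin (Real.pi * a) ^ 2) := by
    rw [show Real.pi * (3 * a) = 3 * (Real.pi * a) by ring, Complex.sin_three_mul]
    ring
  have s4 : 3 - 4 * Complex.sin (Real.pi * a) ^ 2 ≠ 0 := fun h => s3 (by rw [e, h, mul_zero])
  rw [eq_div_iff s3, e] at r3
  rw [eq_div_iff s1] at r1
  rw [div_eq_div_iff g2 (mul_ne_zero g3 s4)]
  refine mul_left_cancel₀ s1 ?_
  linear_combination r3 - r1

theorem exists_tendsto_gammaQuotientRHS (n : ℕ) :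
    ∃ l, Tendsto gammaQuotientRHS (𝓝[≠] (-(n : ℂ))) (𝓝 l) := by
  set H : ℂ → ℂ := fun a => 2 * Complex.Gamma (1 / 6) * (Complex.Gamma (1 - a) /
    (Complex.Gamma (1 - 3 * a) * (3 - 4 * Complex.sin (Real.pi * a) ^ 2))) *
    Complex.sin (Real.pi / 6 + Real.pi * a) * ((3 : ℂ) ^ (3 * a))⁻¹ *
    (Complex.Gamma (2 * a + 1 / 6))⁻¹ with hH
  have hG : ∀ m : ℕ, Complex.Gamma (1 + m) ≠ 0 ∧ ContinuousAt Complex.Gamma (1 + m) := fun m => by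
    have hpos : ∀ j : ℕ, (1 + m : ℂ) ≠ -j := fun j hj => by
      have := congrArg Complex.re hj
      simp at this
      linarith [(m.cast_nonneg : (0 : ℝ) ≤ m), (j.cast_nonneg : (0 : ℝ) ≤ j)]
    exact ⟨Complex.Gamma_ne_zero hpos, (Complex.differentiableAt_Gamma _ hpos).continuousAt⟩
  have c1 : ContinuousAt (fun a : ℂ => Complex.Gamma (1 - a)) (-(n : ℂ)) := by
    refine ContinuousAt.comp (f := fun a : ℂ => 1 - a) ?_ (by fun_prop)
    rw [show 1 - -(n : ℂ) = 1 + n by ring]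
    exact (hG n).2
  have e3 : 1 - 3 * -(n : ℂ) = 1 + ((3 * n : ℕ) : ℂ) := by
    push_cast
    ring
  have c3 : ContinuousAt (fun a : ℂ => Complex.Gamma (1 - 3 * a)) (-(n : ℂ)) := by
    refine ContinuousAt.comp (f := fun a : ℂ => 1 - 3 * a) ?_ (by fun_prop)
    rw [e3]
    exact (hG (3 * n)).2
  have hg3 : Complex.Gamma (1 - 3 * -(n : ℂ)) ≠ 0 := by
    rw [e3]
    exact (hG (3 * n)).1
  have cs : ContinuousAt (fun a : ℂ => 3 - 4 * Complex.sin (Real.pi * a) ^ 2) (-(n : ℂ)) := by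
    fun_prop
  have hs : 3 - 4 * Complex.sin (Real.pi * -(n : ℂ)) ^ 2 ≠ 0 := by
    rw [mul_neg, Complex.sin_neg, mul_comm (Real.pi : ℂ), Complex.sin_nat_mul_pi]
    norm_num
  have c4 : ContinuousAt (fun a : ℂ => Complex.sin (Real.pi / 6 + Real.pi * a)) (-(n : ℂ)) := by
    fun_prop
  have c5 : ContinuousAt (fun a : ℂ => ((3 : ℂ) ^ (3 * a))⁻¹) (-(n : ℂ)) :=
    ContinuousAt.inv₀ (ContinuousAt.const_cpow (by fun_prop) (Or.inl three_ne_zero)) (by simp)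
  have c6 : ContinuousAt (fun a : ℂ => (Complex.Gamma (2 * a + 1 / 6))⁻¹) (-(n : ℂ)) :=
    ContinuousAt.comp (f := fun a : ℂ => 2 * a + 1 / 6)
      Complex.differentiable_one_div_Gamma.continuous.continuousAt (by fun_prop)
  have hcont : ContinuousAt H (-(n : ℂ)) :=
    ((((c1.div (c3.mul cs) (mul_ne_zero hg3 hs)).const_mul
      _).mul c4).mul c5).mul c6
  refine ⟨H (-(n : ℂ)), (hcont.tendsto.mono_left nhdsWithin_le_nhds).congr' ?_⟩
  filter_upwards [eventually_mem_regularParams n] with a ha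
  simp only [hH]
  rw [← Gamma_three_mul_div_Gamma ha.1 ha.2.1 ha.2.2, gammaQuotientRHS]
  simp only [div_eq_mul_inv, mul_inv]
  ring

theorem mainTheorem3 :
    (∀ a ∈ regularParams,
      Summable (fun k : ℕ =>
        ‖hypergeometric3F2Term a (3 * a - 1 / 2) (3 / 2 - 3 * a) (3 * a) (1 / 2) (3 / 4) k‖) ∧
      hypergeometric3F2 a (3 * a - 1 / 2) (3 / 2 - 3 * a) (3 * a) (1 / 2) (3 / 4) =
        gammaQuotientRHS a) ∧
    AnalyticOnNhd ℂ (fun a : ℂ =>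
      hypergeometric3F2 a (3 * a - 1 / 2) (3 / 2 - 3 * a) (3 * a) (1 / 2) (3 / 4))
      regularParams ∧
    AnalyticOnNhd ℂ gammaQuotientRHS regularParams ∧
    ∀ n : ℕ, ∃ l : ℂ,
      Tendsto (fun a : ℂ =>
        hypergeometric3F2 a (3 * a - 1 / 2) (3 / 2 - 3 * a) (3 * a) (1 / 2) (3 / 4))
        (𝓝[≠] (-(n : ℂ))) (𝓝 l) ∧
      Tendsto gammaQuotientRHS (𝓝[≠] (-(n : ℂ))) (𝓝 l) := by
  refine ⟨fun a ha => ⟨summable_norm_hypergeometric3F2Term ha,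
    hypergeometric3F2_eq_gammaQuotientRHS ha⟩, analyticOnNhd_hypergeometric3F2,
    analyticOnNhd_gammaQuotientRHS, fun n => ?_⟩
  obtain ⟨l, hl⟩ := exists_tendsto_gammaQuotientRHS n
  refine ⟨l, hl.congr' ?_, hl⟩
  filter_upwards [eventually_mem_regularParams n] with a ha
  exact (hypergeometric3F2_eq_gammaQuotientRHS ha.1).symm
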